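/- Let $\theta>0$ be fixed. For $\alpha,\beta>0$ with $\alpha\beta>1$ put $\delta=\operatorname{arccoth}(\alpha\beta)$ and $\rho=e^{-\delta}$. The heat channel is the infinite-dimensional vector Gaussian channel $Y_k=X_k+Z_k$, $k=0,1,2,\dots$, where the noise variables $Z_k\sim\mathcal N(0,\theta^2\rho^{-2k-1})$ are mutually independent and independent of the input. For $S\ge 0$ let $C^K(S)$ be the supremum of the mutual information $I\big((X_0,\dots,X_{K-1});(Y_0,\dots,Y_{K-1})\big)$, in bits, over all laws of real random input vectors $(X_0,\dots,X_{K-1})$ (with components not necessarily independent) satisfying $\sum_{k=0}^{K-1}\mathbb E X_k^2\le S$, and let $C(S)=\lim_{K\to\infty}C^K(S)$ be the capacity of the heat channel in bits per transmission. For two quantities $A,B$ depending on $\alpha,\beta$ write $A\doteq B$ if $(A-B)/(\alpha\beta)\to 0$ as $\alpha\beta\to\infty$. Put $x^+=\max\{0,x\}$ and $$N(t,\omega)=\frac{\theta^2}{2\pi}\,(\cosh\delta)\,\exp\left(\frac{t^2}{\alpha^2}+\frac{\omega^2}{\beta^2}\right).$$ Theorem. Assume that the average input energy $S=S(\alpha\beta)\ge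 0$ is a function of the product $\alpha\beta$ with $S(\alpha\beta)=O(\alpha\beta)$ as $\alpha\beta\to\infty$. Then for $\alpha\beta>1$ the limit defining $C(S)$ exists and is finite; the water level $\nu=\nu(\alpha\beta)\in\mathbb R$ can be chosen so that $$S\doteq\iint_{\mathbb R^2}\big(\nu-N(t,\omega)\big)^+\,dt\,d\omega ;$$ and for every choice of $\nu=\nu(\alpha,\beta)\in\mathbb R$ with this property the capacity is given by $$C(S)\doteq\frac1{2\pi}\iint_{\mathbb R^2}\frac12\log_2\left(1+\frac{(\nu-N(t,\omega))^+}{N(t,\omega)}\right)dt\,d\omega .$$ -/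

import Mathlib

open MeasureTheory ProbabilityTheory Filter Topology
open scoped ENNReal NNReal

namespace HeatChannel

noncomputable section

/-- The parameter `δ = arccoth x = artanh (1 / x)`, for `x = αβ > 1`. -/
def delta (x : ℝ) : ℝ := Real.artanh (1 / x)

/-- The parameter `ρ = exp (-δ) ∈ (0, 1)`. -/
def rho (x : ℝ) : ℝ := Real.exp (-delta x)

/-- The noise variance `θ² ρ^(-2k-1)` of the `k`-th subchannel, `k = 0, 1, …`. -/
def noiseVar (θ x : ℝ) (k : ℕ) : ℝ := θ ^ 2 * rho x ^ (-2 * (k : ℤ) - 1)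

/-- The law of the noise vector `(Z_0, …, Z_{K-1})`: independent centered Gaussians with
variances `noiseVar θ x k`. -/
def noiseLaw (θ x : ℝ) (K : ℕ) : Measure (Fin K → ℝ) :=
  Measure.pi fun k => gaussianReal 0 (noiseVar θ x k).toNNReal

/-- The joint law of input and output `(X, Y)`, `Y = X + Z`, where `X` has law `P` and the noise
`Z` is independent of `X`. -/
def jointLaw (θ x : ℝ) (K : ℕ) (P : Measure (Fin K → ℝ)) :
    Measure ((Fin K → ℝ) × (Fin K → ℝ)) :=
  (P.prod (noiseLaw θ x K)).map fun p => (p.1, p.1 + p.2)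

/-- The mutual information, in bits, of the two components of a pair with joint law `μ`: the
Kullback-Leibler divergence of `μ` from the product of its marginals (`klDiv` is in nats). -/
def mutualInfoBits {A B : Type*} [MeasurableSpace A] [MeasurableSpace B]
    (μ : Measure (A × B)) : ℝ≥0∞ :=
  InformationTheory.klDiv μ (μ.fst.prod μ.snd) / ENNReal.ofReal (Real.log 2)

/-- The average energy `E ‖X‖² = ∑ k, E X_k²` of a random vector with law `P`. -/
def avgEnergy {K : ℕ} (P : Measure (Fin K → ℝ)) : ℝ≥0∞ :=
  ∑ k, ∫⁻ v, ENNReal.ofReal (v k ^ 2) ∂P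

/-- The capacity `C^K(S)`, in bits, of the first `K` subchannels under the average energy
constraint `E ‖X‖² ≤ S`. -/
def capacityFirst (θ x S : ℝ) (K : ℕ) : ℝ≥0∞ :=
  ⨆ (P : Measure (Fin K → ℝ)) (_ : IsProbabilityMeasure P)
    (_ : avgEnergy P ≤ ENNReal.ofReal S), mutualInfoBits (jointLaw θ x K P)

/-- The capacity `C(S) = lim_{K → ∞} C^K(S)` of the heat channel, in bits per transmission. -/
def capacity (θ x S : ℝ) : ℝ≥0∞ := limUnder atTop (capacityFirst θ x S)

/-- `N(t, ω) = (θ² / 2π) cosh δ exp (t² / α² + ω² / β²)`. -/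
def N (θ α β t ω : ℝ) : ℝ :=
  θ ^ 2 / (2 * Real.pi) * Real.cosh (delta (α * β)) * Real.exp (t ^ 2 / α ^ 2 + ω ^ 2 / β ^ 2)

/-- `αβ → ∞`, where `α` and `β` are positive. -/
def timeFreqAtTop : Filter (ℝ × ℝ) :=
  comap (fun p => p.1 * p.2) atTop ⊓ 𝓟 {p | 0 < p.1 ∧ 0 < p.2}

/-- Asymptotic equality `A ≐ B`, i.e. `A - B = o(αβ)` as `αβ → ∞`, of two quantities depending
on the parameters `α` and `β`. -/
def AsympEq (A B : ℝ → ℝ → ℝ) : Prop :=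
  Tendsto (fun p : ℝ × ℝ => (A p.1 p.2 - B p.1 p.2) / (p.1 * p.2)) timeFreqAtTop (𝓝 0)

/-- The double integral `∬ (ν - N(t, ω))⁺ dt dω`. -/
def waterVolume (θ α β ν : ℝ) : ℝ :=
  ∫ p : ℝ × ℝ, max 0 (ν - N θ α β p.1 p.2)

/-- The double integral `(1 / 2π) ∬ (1 / 2) log₂ (1 + (ν - N(t, ω))⁺ / N(t, ω)) dt dω`. -/
def waterCapacity (θ α β ν : ℝ) : ℝ :=
  1 / (2 * Real.pi) * ∫ p : ℝ × ℝ,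
    1 / 2 * Real.logb 2 (1 + max 0 (ν - N θ α β p.1 p.2) / N θ α β p.1 p.2)

end

end HeatChannel

/-!
The proof solves every finite truncation exactly and compares the solution with the double
integrals.

*Water-filling.* Put `N_k = noiseVar θ x k`. For a joint law `μ` of input and output, the chain rule
for the divergence shows that the mutual information is at most the divergence of `μ` from
`μ.fst.prod Q`, for every law `Q` of the output, with equality when `Q` is the output law
(`klDiv_prod_fst_snd_le`). If `Q` is an independent Gaussian vector with variances `b k`, this
divergence is explicit and depends on the input only through its second moments (`klDiv_shear`).
The choice `b k = max ν (N_k)` yields the converse, and for the independent Gaussian input with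
variances `(ν - N_k)⁺` the output law is this `Q`, so the bound is attained
(`capacityFirst_eq_of_waterLevel`). Since `N_k → ∞`, only finitely many subchannels lie below the
water level; so `K ↦ capacityFirst θ x S K` is eventually constant (`exists_waterLevel`).

*Sums against integrals.* As `N_k = θ² exp (δ (2 k + 1))`, at the level `θ² exp w` both the energy
and the capacity are midpoint sums with mesh `2 δ` of the antitone functions `θ² (e^w - e^u)⁺` and
`(w - u)⁺ / (2 log 2)`. Such a sum differs from the integral over `u > 0` by at most the mesh times
the value at `0` (`abs_midpoint_sum_sub_integral_le`). Polar coordinates turn the two double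
integrals into the same integrals over `u > 0`, up to the factor `cosh δ → 1` in the energy
(`waterVolume_eq`, `waterCapacity_eq`). With `F(w) = w e^w - e^w + 1` and `δ ~ 1 / x` this gives
`S / x = θ² F(w) / 2 + o(1)` and `C / x = w² / (8 log 2) + o(1)`, where `w` is bounded because
`S = O(x)`. If `v` is the height that belongs to a level `ν` as in the theorem, then
`F(v) - F(w) → 0`, and `|v² - w²| ≤ 2 |F(v) - F(w)|` (`abs_sq_sub_sq_le`) makes the two capacities
agree up to `o(x)`.
-/

namespace HeatChannel

open InformationTheory

/-! ### Mutual information as a minimum of divergences -/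

lemma klDiv_map_equiv {A B : Type*} [MeasurableSpace A] [MeasurableSpace B] (e : A ≃ᵐ B)
    (μ ν : Measure A) [IsFiniteMeasure μ] [IsFiniteMeasure ν] :
    klDiv (μ.map e) (ν.map e) = klDiv μ ν := by
  refine le_antisymm (klDiv_map_le _ _ e.measurable) ?_
  have h := klDiv_map_le (μ.map e) (ν.map e) e.symm.measurable
  simpa using h

/-- Among all product laws with the right first marginal, the product of the marginals minimizes
the divergence from `μ`: by the chain rule the difference is the divergence of `μ.snd` from `Q`. -/
lemma klDiv_prod_fst_snd_le {A B : Type*} [MeasurableSpace A] [StandardBorelSpace A] [Nonempty A]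
    [MeasurableSpace B] (μ : Measure (A × B)) [IsProbabilityMeasure μ]
    (Q : Measure B) [IsProbabilityMeasure Q] :
    klDiv μ (μ.fst.prod μ.snd) ≤ klDiv μ (μ.fst.prod Q) := by
  have hswap (R : Measure B) [IsProbabilityMeasure R] :
      klDiv μ (μ.fst.prod R) = klDiv (μ.map Prod.swap) (R ⊗ₘ Kernel.const B μ.fst) := by
    have h := klDiv_map_equiv MeasurableEquiv.prodComm μ (μ.fst.prod R)
    rw [Measure.compProd_const, ← h, ← Measure.prod_swap (μ := μ.fst)]
    rfl
  have hdis : μ.map Prod.swap = μ.snd ⊗ₘ (μ.map Prod.swap).condKernel := by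
    conv_lhs => rw [← (μ.map Prod.swap).disintegrate (μ.map Prod.swap).condKernel]
    rw [Measure.fst_map_swap]
  have : IsProbabilityMeasure (μ.map Prod.swap) :=
    Measure.isProbabilityMeasure_map measurable_swap.aemeasurable
  rw [hswap Q, hswap μ.snd, hdis, klDiv_compProd_eq_add μ.snd Q]
  exact le_add_self

lemma snd_map_shear {ι : Type*} (P G : Measure (ι → ℝ)) :
    ((P.prod G).map fun p => (p.1, p.1 + p.2)).snd = (P.prod G).map fun p => p.1 + p.2 := by
  rw [Measure.snd, Measure.map_map measurable_snd (by fun_prop)]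
  rfl

/-! ### Densities of products of Gaussian measures -/

lemma pi_withDensity_ofReal {ι : Type*} [Fintype ι] (g : ι → ℝ → ℝ)
    (hg : ∀ k, Integrable (g k)) (hg0 : ∀ k x, 0 ≤ g k x) :
    Measure.pi (fun k => (volume : Measure ℝ).withDensity fun x => ENNReal.ofReal (g k x)) =
      (volume : Measure (ι → ℝ)).withDensity fun z => ENNReal.ofReal (∏ k, g k (z k)) := by
  have : ∀ k, IsFiniteMeasure ((volume : Measure ℝ).withDensity fun x => ENNReal.ofReal (g k x)) :=
    fun k => isFiniteMeasure_withDensity_ofReal (hg k).2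
  refine Measure.pi_eq fun s hs => ?_
  rw [withDensity_apply _ (.univ_pi hs), volume_pi, Measure.restrict_pi_pi,
    ← ofReal_integral_eq_lintegral_ofReal]
  · rw [integral_fintype_prod_eq_prod, ENNReal.ofReal_prod_of_nonneg]
    · refine Finset.prod_congr rfl fun k _ => ?_
      rw [withDensity_apply _ (hs k), ofReal_integral_eq_lintegral_ofReal (hg k).integrableOn]
      exact Eventually.of_forall (hg0 k)
    · exact fun k _ => integral_nonneg (hg0 k)
  · exact Integrable.fintype_prod fun k => (hg k).integrableOn
  · exact Eventually.of_forall fun z => Finset.prod_nonneg fun k _ => hg0 k _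

variable {ι : Type*} [Fintype ι]

/-- The Lebesgue density of the product of the Gaussian measures `N(0, a k)`. -/
noncomputable def piGaussianPDF (a : ι → ℝ≥0) (z : ι → ℝ) : ℝ :=
  ∏ k, gaussianPDFReal 0 (a k) (z k)

lemma piGaussianPDF_pos {a : ι → ℝ≥0} (ha : ∀ k, a k ≠ 0) (z : ι → ℝ) : 0 < piGaussianPDF a z :=
  Finset.prod_pos fun k _ => gaussianPDFReal_pos _ _ _ (ha k)

@[fun_prop]
lemma measurable_piGaussianPDF (a : ι → ℝ≥0) : Measurable (piGaussianPDF a) :=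
  Finset.measurable_prod _ fun k _ =>
    (measurable_gaussianPDFReal 0 (a k)).comp (measurable_pi_apply k)

lemma log_piGaussianPDF {a : ι → ℝ≥0} (ha : ∀ k, a k ≠ 0) (z : ι → ℝ) :
    Real.log (piGaussianPDF a z) =
      ∑ k, (-(1 / 2) * Real.log (2 * Real.pi * a k) - z k ^ 2 / (2 * a k)) := by
  rw [piGaussianPDF, Real.log_prod fun k _ => (gaussianPDFReal_pos _ _ _ (ha k)).ne']
  refine Finset.sum_congr rfl fun k _ => ?_
  have h : 0 < (a k : ℝ) := by exact_mod_cast (pos_iff_ne_zero.2 (ha k))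
  rw [gaussianPDFReal, Real.log_mul (by positivity) (Real.exp_pos _).ne', Real.log_exp,
    Real.log_inv, Real.log_sqrt (by positivity)]
  simp
  ring

lemma pi_gaussianReal_eq_withDensity {a : ι → ℝ≥0} (ha : ∀ k, a k ≠ 0) :
    Measure.pi (fun k => gaussianReal 0 (a k)) =
      (volume : Measure (ι → ℝ)).withDensity fun z => ENNReal.ofReal (piGaussianPDF a z) := by
  have := pi_withDensity_ofReal (fun k => gaussianPDFReal 0 (a k))
    (fun k => integrable_gaussianPDFReal 0 (a k)) (fun k => gaussianPDFReal_nonneg 0 (a k))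
  refine Eq.trans ?_ this
  congr 1
  funext k
  rw [gaussianReal_of_var_ne_zero _ (ha k)]
  rfl

/-- The input law `P` is arbitrary, so the density is taken with respect to `P` times a Gaussian
output law: the shear `(x, z) ↦ (x, x + z)` preserves `P` times the Lebesgue measure. -/
lemma map_shear_eq_withDensity (P : Measure (ι → ℝ)) [IsProbabilityMeasure P]
    {a b : ι → ℝ≥0} (ha : ∀ k, a k ≠ 0) (hb : ∀ k, b k ≠ 0) :
    (P.prod (Measure.pi fun k => gaussianReal 0 (a k))).map (fun p => (p.1, p.1 + p.2)) =
      (P.prod (Measure.pi fun k => gaussianReal 0 (b k))).withDensity fun p =>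
        ENNReal.ofReal (piGaussianPDF a (p.2 - p.1) / piGaussianPDF b p.2) := by
  have hshear := measurePreserving_prod_add P (volume : Measure (ι → ℝ))
  rw [pi_gaussianReal_eq_withDensity ha, pi_gaussianReal_eq_withDensity hb,
    prod_withDensity_right (by fun_prop), prod_withDensity_right (by fun_prop),
    ← withDensity_mul _ (by fun_prop) (by fun_prop)]
  ext s hs
  rw [Measure.map_apply hshear.measurable hs, withDensity_apply _ (hshear.measurable hs),
    withDensity_apply _ hs, ← hshear.setLIntegral_comp_preimage hs (by fun_prop)]
  refine setLIntegral_congr_fun (hshear.measurable hs) fun p _ => ?_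
  simp only [Pi.mul_apply, add_sub_cancel_left]
  rw [← ENNReal.ofReal_mul (piGaussianPDF_pos hb _).le,
    mul_div_cancel₀ _ (piGaussianPDF_pos hb _).ne']

/-! ### The divergence of a Gaussian channel from a Gaussian output -/

lemma integral_sq_gaussianReal (v : ℝ≥0) : ∫ x, x ^ 2 ∂gaussianReal 0 v = v := by
  have h := variance_eq_integral (μ := gaussianReal 0 v) (X := id) aemeasurable_id
  rw [variance_id_gaussianReal] at h
  simpa using h.symm

lemma integrable_sq_gaussianReal (v : ℝ≥0) : Integrable (fun x => x ^ 2) (gaussianReal 0 v) :=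
  (memLp_id_gaussianReal 2).integrable_sq

lemma integrable_shear_quadratic (P : Measure (ι → ℝ)) [IsProbabilityMeasure P]
    (a : ι → ℝ≥0) (k : ι) (hP : Integrable (fun v => v k ^ 2) P) (c r s : ℝ) :
    Integrable (fun p : (ι → ℝ) × (ι → ℝ) => c + r * p.2 k ^ 2 + s * (p.1 k + p.2 k) ^ 2)
        (P.prod (Measure.pi fun k => gaussianReal 0 (a k))) ∧
      ∫ p, (c + r * p.2 k ^ 2 + s * (p.1 k + p.2 k) ^ 2)
        ∂(P.prod (Measure.pi fun k => gaussianReal 0 (a k))) =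
        c + r * a k + s * (∫ v, v k ^ 2 ∂P + a k) := by
  set G := Measure.pi fun k => gaussianReal 0 (a k)
  have hL : MemLp (fun v : ι → ℝ => v k) 2 P :=
    (memLp_two_iff_integrable_sq (measurable_pi_apply k).aestronglyMeasurable).2 hP
  have hG1 : Integrable (fun z : ι → ℝ => z k) G :=
    integrable_comp_eval (i := k) (f := fun x => x) ((memLp_id_gaussianReal 2).integrable one_le_two)
  have hG2 : Integrable (fun z : ι → ℝ => z k ^ 2) G :=
    integrable_comp_eval (i := k) (f := fun x => x ^ 2) (integrable_sq_gaussianReal (a k))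
  have e1 : ∫ z, z k ∂G = 0 := by
    have := integral_comp_eval (μ := fun k => gaussianReal 0 (a k)) (i := k) (f := fun x => x)
      (by fun_prop)
    rw [this, integral_id_gaussianReal]
  have e2 : ∫ z, z k ^ 2 ∂G = a k := by
    have := integral_comp_eval (μ := fun k => gaussianReal 0 (a k)) (i := k) (f := fun x => x ^ 2)
      (by fun_prop)
    rw [this, integral_sq_gaussianReal]
  have i1 : Integrable (fun p : (ι → ℝ) × (ι → ℝ) => p.1 k ^ 2) (P.prod G) := hP.comp_fst G
  have i2 : Integrable (fun p : (ι → ℝ) × (ι → ℝ) => p.2 k ^ 2) (P.prod G) := hG2.comp_snd P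
  have i3 : Integrable (fun p : (ι → ℝ) × (ι → ℝ) => p.1 k * p.2 k) (P.prod G) :=
    (hL.integrable one_le_two).mul_prod hG1
  have j1 : ∫ p : (ι → ℝ) × (ι → ℝ), p.1 k ^ 2 ∂(P.prod G) = ∫ v, v k ^ 2 ∂P := by
    simpa using integral_fun_fst (μ := P) (ν := G) (fun v : ι → ℝ => v k ^ 2)
  have j2 : ∫ p : (ι → ℝ) × (ι → ℝ), p.2 k ^ 2 ∂(P.prod G) = a k := by
    rw [← e2]
    simpa using integral_fun_snd (μ := P) (ν := G) (fun v : ι → ℝ => v k ^ 2)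
  have j3 : ∫ p : (ι → ℝ) × (ι → ℝ), p.1 k * p.2 k ∂(P.prod G) = 0 := by
    rw [integral_prod_mul (fun v : ι → ℝ => v k) (fun v : ι → ℝ => v k), e1, mul_zero]
  have hfun : (fun p : (ι → ℝ) × (ι → ℝ) => c + r * p.2 k ^ 2 + s * (p.1 k + p.2 k) ^ 2) =
      fun p => c + (r + s) * p.2 k ^ 2 + s * p.1 k ^ 2 + 2 * s * (p.1 k * p.2 k) := by
    funext p; ring
  have k2 := i2.const_mul (r + s)
  have k1 := i1.const_mul s
  have k3 := i3.const_mul (2 * s)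
  have k0 : Integrable (fun _ : (ι → ℝ) × (ι → ℝ) => c) (P.prod G) := integrable_const c
  have k02 : Integrable (fun p : (ι → ℝ) × (ι → ℝ) => c + (r + s) * p.2 k ^ 2) (P.prod G) :=
    k0.add k2
  have k021 : Integrable (fun p : (ι → ℝ) × (ι → ℝ) => c + (r + s) * p.2 k ^ 2 + s * p.1 k ^ 2)
    (P.prod G) := k02.add k1
  rw [hfun]
  refine ⟨k021.add k3, ?_⟩
  rw [integral_add k021 k3, integral_add k02 k1, integral_add k0 k2,
    integral_const_mul, integral_const_mul, integral_const_mul, j1, j2, j3]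
  simp
  ring

/-- The divergence between the joint law of input and output of the Gaussian channel with noise
variances `a k` and the law under which the output is an independent `N(0, b k)` vector. -/
lemma klDiv_shear (P : Measure (ι → ℝ)) [IsProbabilityMeasure P]
    (hP : ∀ k, Integrable (fun v => v k ^ 2) P)
    {a b : ι → ℝ≥0} (ha : ∀ k, a k ≠ 0) (hb : ∀ k, b k ≠ 0) :
    klDiv ((P.prod (Measure.pi fun k => gaussianReal 0 (a k))).map fun p => (p.1, p.1 + p.2))
        (P.prod (Measure.pi fun k => gaussianReal 0 (b k))) =
      ENNReal.ofReal (∑ k, (1 / 2 * Real.log (b k / a k) +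
        ((a k + ∫ v, v k ^ 2 ∂P) / (2 * b k) - 1 / 2))) := by
  set G := Measure.pi fun k => gaussianReal 0 (a k) with hG
  set R := P.prod (Measure.pi fun k => gaussianReal 0 (b k)) with hR
  set J := (P.prod G).map fun p => (p.1, p.1 + p.2) with hJ
  have hsm : Measurable fun p : (ι → ℝ) × (ι → ℝ) => (p.1, p.1 + p.2) := by fun_prop
  have hJP : IsProbabilityMeasure J := Measure.isProbabilityMeasure_map hsm.aemeasurable
  set f : (ι → ℝ) × (ι → ℝ) → ℝ := fun p => piGaussianPDF a (p.2 - p.1) / piGaussianPDF b p.2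
    with hf
  have hfm : Measurable f := by fun_prop
  have hf0 (p) : 0 < f p := div_pos (piGaussianPDF_pos ha _) (piGaussianPDF_pos hb _)
  have hJR : J = R.withDensity fun p => ENNReal.ofReal (f p) := map_shear_eq_withDensity P ha hb
  have hac : J ≪ R := hJR ▸ withDensity_absolutelyContinuous _ _
  have hllr : llr J R =ᵐ[J] fun p => Real.log (f p) := by
    refine hac.ae_le ?_
    have h := Measure.rnDeriv_withDensity R (f := fun p => ENNReal.ofReal (f p)) (by fun_prop)
    rw [← hJR] at h
    filter_upwards [h] with p hp
    rw [llr, hp, ENNReal.toReal_ofReal (hf0 p).le]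
  have hcomp : ((fun p => Real.log (f p)) ∘ fun p : (ι → ℝ) × (ι → ℝ) => (p.1, p.1 + p.2)) =
      fun p => ∑ k, (1 / 2 * Real.log (b k / a k) + (-(1 / (2 * a k))) * p.2 k ^ 2 +
        1 / (2 * b k) * (p.1 k + p.2 k) ^ 2) := by
    funext p
    simp only [Function.comp, hf, add_sub_cancel_left]
    rw [Real.log_div (piGaussianPDF_pos ha _).ne' (piGaussianPDF_pos hb _).ne',
      log_piGaussianPDF ha, log_piGaussianPDF hb, ← Finset.sum_sub_distrib]
    refine Finset.sum_congr rfl fun k _ => ?_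
    have h1 : (a k : ℝ) ≠ 0 := by exact_mod_cast ha k
    have h2 : (b k : ℝ) ≠ 0 := by exact_mod_cast hb k
    rw [Real.log_div h2 h1, Real.log_mul (by positivity) h1, Real.log_mul (by positivity) h2,
      Pi.add_apply]
    ring
  have hk (k : ι) := integrable_shear_quadratic P a k (hP k) (1 / 2 * Real.log (b k / a k))
    (-(1 / (2 * a k))) (1 / (2 * b k))
  have hint : Integrable (fun p => Real.log (f p)) J := by
    rw [hJ, integrable_map_measure hfm.log.aestronglyMeasurable hsm.aemeasurable, hcomp]
    exact integrable_finsetSum _ fun k _ => (hk k).1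
  have hval : ∫ p, Real.log (f p) ∂J = ∑ k, (1 / 2 * Real.log (b k / a k) +
        ((a k + ∫ v, v k ^ 2 ∂P) / (2 * b k) - 1 / 2)) := by
    rw [hJ, integral_map hsm.aemeasurable hfm.log.aestronglyMeasurable]
    change ∫ p, ((fun p => Real.log (f p)) ∘ fun p : (ι → ℝ) × (ι → ℝ) => (p.1, p.1 + p.2)) p
      ∂(P.prod G) = _
    rw [hcomp, integral_finsetSum _ fun k _ => (hk k).1]
    refine Finset.sum_congr rfl fun k _ => ?_
    rw [(hk k).2]
    have h1 : (a k : ℝ) ≠ 0 := by exact_mod_cast ha k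
    have h2 : (b k : ℝ) ≠ 0 := by exact_mod_cast hb k
    field_simp
    ring
  rw [klDiv_of_ac_of_integrable hac ((integrable_congr hllr).2 hint), integral_congr_ae hllr, hval]
  simp

/-! ### Water-filling for finitely many Gaussian channels -/

lemma map_add_pi_gaussianReal (a b : ι → ℝ≥0) :
    ((Measure.pi fun k => gaussianReal 0 (a k)).prod
      (Measure.pi fun k => gaussianReal 0 (b k))).map (fun p => p.1 + p.2) =
      Measure.pi fun k => gaussianReal 0 (a k + b k) := by
  have h := measurePreserving_arrowProdEquivProdArrow ℝ ℝ ι (fun k => gaussianReal 0 (a k))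
    (fun k => gaussianReal 0 (b k))
  rw [← h.map_eq, Measure.map_map (by fun_prop) h.measurable]
  have h2 : ((fun p : (ι → ℝ) × (ι → ℝ) => p.1 + p.2) ∘
      (MeasurableEquiv.arrowProdEquivProdArrow ℝ ℝ ι)) =
      fun (x : ι → ℝ × ℝ) k => (x k).1 + (x k).2 := rfl
  rw [h2, Measure.pi_map_pi (f := fun _ (x : ℝ × ℝ) => x.1 + x.2) (by fun_prop)]
  congr 1
  funext k
  have := gaussianReal_conv_gaussianReal (m₁ := 0) (m₂ := 0) (v₁ := a k) (v₂ := b k)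
  rw [add_zero] at this
  exact this

lemma fst_map_shear (P G : Measure (ι → ℝ)) [IsProbabilityMeasure P] [IsProbabilityMeasure G] :
    ((P.prod G).map fun p => (p.1, p.1 + p.2)).fst = P := by
  rw [Measure.fst, Measure.map_map measurable_fst (by fun_prop)]
  exact Measure.fst_prod

/-- Converse half of water-filling: comparing the output with an independent
`N(0, max ν (a k))` vector bounds the mutual information. -/
lemma klDiv_shear_le_waterfilling {a : ι → ℝ≥0} (ha : ∀ k, a k ≠ 0) {ν S : ℝ} (hν : 0 < ν)
    (hS : ∑ k, max 0 (ν - a k) = S) (P : Measure (ι → ℝ)) [IsProbabilityMeasure P]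
    (hP : ∑ k, ∫⁻ v, ENNReal.ofReal (v k ^ 2) ∂P ≤ ENNReal.ofReal S) :
    let J := (P.prod (Measure.pi fun k => gaussianReal 0 (a k))).map fun p => (p.1, p.1 + p.2)
    klDiv J (J.fst.prod J.snd) ≤ ENNReal.ofReal (∑ k, 1 / 2 * Real.log (max ν (a k) / a k)) := by
  intro J
  have hJP : IsProbabilityMeasure J :=
    Measure.isProbabilityMeasure_map (Measurable.aemeasurable (by fun_prop))
  have hS0 : 0 ≤ S := hS ▸ Finset.sum_nonneg fun k _ => le_max_left _ _
  have hfin (k : ι) : ∫⁻ v, ENNReal.ofReal (v k ^ 2) ∂P ≠ ∞ := by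
    refine ((Finset.single_le_sum (f := fun k => ∫⁻ v, ENNReal.ofReal (v k ^ 2) ∂P)
      (fun _ _ => zero_le) (Finset.mem_univ k)).trans hP).trans_lt ENNReal.ofReal_lt_top |>.ne
  have hint (k : ι) : Integrable (fun v : ι → ℝ => v k ^ 2) P := by
    refine (lintegral_ofReal_ne_top_iff_integrable ?_ ?_).1 (hfin k)
    · exact ((measurable_pi_apply k).pow_const 2).aestronglyMeasurable
    · exact Eventually.of_forall fun v => sq_nonneg _
  have hE : ∑ k, ∫ v, v k ^ 2 ∂P ≤ S := by
    rw [← ENNReal.ofReal_le_ofReal_iff hS0, ENNReal.ofReal_sum_of_nonneg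
      fun k _ => integral_nonneg fun v => sq_nonneg _]
    refine le_trans (le_of_eq (Finset.sum_congr rfl fun k _ => ?_)) hP
    rw [ofReal_integral_eq_lintegral_ofReal (hint k) (Eventually.of_forall fun v => sq_nonneg _)]
  set b : ι → ℝ≥0 := fun k => (max ν (a k)).toNNReal with hb
  have hbc (k : ι) : (b k : ℝ) = max ν (a k) :=
    Real.coe_toNNReal _ (hν.le.trans (le_max_left _ _))
  have hb0 (k : ι) : b k ≠ 0 :=
    (Real.toNNReal_pos.2 (hν.trans_le (le_max_left _ _))).ne'
  refine (klDiv_prod_fst_snd_le J (Measure.pi fun k => gaussianReal 0 (b k))).trans ?_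
  rw [fst_map_shear, klDiv_shear P hint ha hb0]
  refine ENNReal.ofReal_le_ofReal ?_
  simp_rw [hbc]
  rw [Finset.sum_add_distrib]
  have hterm (k : ι) : (a k + ∫ v, v k ^ 2 ∂P) / (2 * max ν (a k)) - 1 / 2 ≤
      (∫ v, v k ^ 2 ∂P - max 0 (ν - a k)) / (2 * ν) := by
    have hEk : 0 ≤ ∫ v, v k ^ 2 ∂P := integral_nonneg fun v => sq_nonneg _
    rcases le_total ν (a k) with h | h
    · have hak : (0 : ℝ) < a k := hν.trans_le h
      rw [max_eq_right h, max_eq_left (by linarith), sub_zero]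
      calc (a k + ∫ v, v k ^ 2 ∂P) / (2 * a k) - 1 / 2 = (∫ v, v k ^ 2 ∂P) / (2 * a k) := by
            field_simp; ring
        _ ≤ _ := by gcongr
    · rw [max_eq_left h, max_eq_right (by linarith)]
      refine le_of_eq ?_
      field_simp
      ring
  have hsum : ∑ k, ((a k + ∫ v, v k ^ 2 ∂P) / (2 * max ν (a k)) - 1 / 2) ≤ 0 := by
    refine (Finset.sum_le_sum fun k _ => hterm k).trans ?_
    rw [← Finset.sum_div, Finset.sum_sub_distrib, hS]
    exact div_nonpos_of_nonpos_of_nonneg (by linarith) (by linarith)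
  linarith

/-- Achievability half of water-filling: an independent Gaussian input with variances
`(ν - a k)⁺` attains the bound of the converse. -/
lemma exists_klDiv_shear_eq_waterfilling {a : ι → ℝ≥0} (ha : ∀ k, a k ≠ 0) {ν S : ℝ} (hν : 0 < ν)
    (hS : ∑ k, max 0 (ν - a k) = S) :
    ∃ P : Measure (ι → ℝ), IsProbabilityMeasure P ∧
      ∑ k, ∫⁻ v, ENNReal.ofReal (v k ^ 2) ∂P ≤ ENNReal.ofReal S ∧
      let J := (P.prod (Measure.pi fun k => gaussianReal 0 (a k))).map fun p => (p.1, p.1 + p.2)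
      klDiv J (J.fst.prod J.snd) =
        ENNReal.ofReal (∑ k, 1 / 2 * Real.log (max ν (a k) / a k)) := by
  set e : ι → ℝ≥0 := fun k => (max 0 (ν - a k)).toNNReal with he
  have hec (k : ι) : (e k : ℝ) = max 0 (ν - a k) := Real.coe_toNNReal _ (le_max_left _ _)
  set P := Measure.pi fun k => gaussianReal 0 (e k) with hP
  have hint (k : ι) : Integrable (fun v : ι → ℝ => v k ^ 2) P :=
    integrable_comp_eval (i := k) (f := fun x => x ^ 2) (integrable_sq_gaussianReal (e k))
  have hE (k : ι) : ∫ v, v k ^ 2 ∂P = max 0 (ν - a k) := by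
    have := integral_comp_eval (μ := fun k => gaussianReal 0 (e k)) (i := k) (f := fun x => x ^ 2)
      (by fun_prop)
    rw [this, integral_sq_gaussianReal, hec]
  have hae (k : ι) : ((e k + a k : ℝ≥0) : ℝ) = max ν (a k) := by
    rw [NNReal.coe_add, hec]
    rcases le_total ν (a k) with h | h
    · rw [max_eq_left (by linarith), max_eq_right h, zero_add]
    · rw [max_eq_right (by linarith), max_eq_left h, sub_add_cancel]
  refine ⟨P, inferInstance, ?_, ?_⟩
  · rw [← hS, ENNReal.ofReal_sum_of_nonneg fun k _ => le_max_left _ _]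
    refine le_of_eq (Finset.sum_congr rfl fun k _ => ?_)
    rw [← hE, ofReal_integral_eq_lintegral_ofReal (hint k)
      (Eventually.of_forall fun v => sq_nonneg _)]
  · intro J
    have hb0 (k : ι) : e k + a k ≠ 0 := fun h => ha k (add_eq_zero.1 h).2
    rw [fst_map_shear, snd_map_shear, map_add_pi_gaussianReal, klDiv_shear P hint ha hb0]
    congr 1
    refine Finset.sum_congr rfl fun k _ => ?_
    have h1 : (a k : ℝ) + max 0 (ν - a k) = max ν (a k) := by
      rw [← hae, NNReal.coe_add, hec, add_comm]
    have h2 : max ν (a k) ≠ 0 := (hν.trans_le (le_max_left _ _)).ne'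
    rw [hE, hae, h1]
    field_simp
    ring

/-! ### The capacity of the heat channel -/

lemma noiseVar_pos {θ : ℝ} (hθ : 0 < θ) (x : ℝ) (k : ℕ) : 0 < noiseVar θ x k :=
  mul_pos (pow_pos hθ 2) (zpow_pos (Real.exp_pos _) _)

lemma noiseVar_eq (θ x : ℝ) (k : ℕ) :
    noiseVar θ x k = θ ^ 2 * Real.exp (delta x * (2 * k + 1)) := by
  rw [noiseVar, rho, ← Real.rpow_intCast, ← Real.exp_mul]
  push_cast
  ring_nf

/-- The capacity of the first `K` subchannels is given by water-filling: `ν` is the water level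
for the energy `S`. -/
lemma capacityFirst_eq_of_waterLevel {θ : ℝ} (hθ : 0 < θ) (x : ℝ) {S ν : ℝ} (hν : 0 < ν) {K : ℕ}
    (hS : ∑ k ∈ Finset.range K, max 0 (ν - noiseVar θ x k) = S) :
    capacityFirst θ x S K = ENNReal.ofReal (∑ k ∈ Finset.range K,
      1 / 2 * Real.logb 2 (max ν (noiseVar θ x k) / noiseVar θ x k)) := by
  set a : Fin K → ℝ≥0 := fun k => (noiseVar θ x k).toNNReal with ha
  have ha0 (k : Fin K) : a k ≠ 0 := (Real.toNNReal_pos.2 (noiseVar_pos hθ x k)).ne'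
  have hac (k : Fin K) : (a k : ℝ) = noiseVar θ x k := Real.coe_toNNReal _ (noiseVar_pos hθ x k).le
  have hS' : ∑ k, max 0 (ν - a k) = S := by
    simp_rw [hac]
    rw [← hS, Finset.sum_range]
  have hlog2 : 0 < Real.log 2 := Real.log_pos one_lt_two
  have hval : ENNReal.ofReal (∑ k ∈ Finset.range K,
      1 / 2 * Real.logb 2 (max ν (noiseVar θ x k) / noiseVar θ x k)) =
      ENNReal.ofReal (∑ k, 1 / 2 * Real.log (max ν (a k) / a k)) / ENNReal.ofReal (Real.log 2) := by
    rw [← ENNReal.ofReal_div_of_pos hlog2, Finset.sum_range, Finset.sum_div]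
    congr 1
    refine Finset.sum_congr rfl fun k _ => ?_
    rw [hac, Real.logb, mul_div_assoc]
  rw [hval]
  refine le_antisymm ?_ ?_
  · refine iSup_le fun P => iSup_le fun hP => iSup_le fun hPS => ?_
    exact ENNReal.div_le_div_right (klDiv_shear_le_waterfilling ha0 hν hS' P hPS) _
  · obtain ⟨P, hP, hPS, hJ⟩ := exists_klDiv_shear_eq_waterfilling ha0 hν hS'
    refine le_iSup_of_le P (le_iSup_of_le hP (le_iSup_of_le hPS ?_))
    exact ENNReal.div_le_div_right hJ.ge _

/-- For `x > 1` and `S ≥ 0` there is a water level `θ² e^w` which, from some number of subchannels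
on, is the water level for the energy `S`; the capacity is then the water-filling sum. -/
lemma exists_waterLevel {θ : ℝ} (hθ : 0 < θ) {x : ℝ} (hδ : 0 < delta x) {S : ℝ} (hS : 0 ≤ S) :
    ∃ w : ℝ, 0 ≤ w ∧ ∃ K₀ : ℕ, ∀ K ≥ K₀, w ≤ 2 * delta x * K ∧
      ∑ k ∈ Finset.range K, max 0 (θ ^ 2 * Real.exp w - noiseVar θ x k) = S ∧
      capacityFirst θ x S K = ENNReal.ofReal (∑ k ∈ Finset.range K,
        1 / 2 * Real.logb 2 (max (θ ^ 2 * Real.exp w) (noiseVar θ x k) / noiseVar θ x k)) := by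
  have hθ2 : 0 < θ ^ 2 := pow_pos hθ 2
  -- The first subchannel alone absorbs the energy `S` at the level `θ² e^{w₁} = θ² e^δ + S`.
  set w₁ := Real.log ((noiseVar θ x 0 + S) / θ ^ 2) with hw₁
  have hN0 := noiseVar_pos hθ x 0
  have hew₁ : θ ^ 2 * Real.exp w₁ = noiseVar θ x 0 + S := by
    rw [hw₁, Real.exp_log (by positivity)]
    field_simp
  have hδw : delta x ≤ w₁ := by
    rw [← Real.exp_le_exp, ← mul_le_mul_iff_right₀ hθ2, hew₁, noiseVar_eq]
    simp [hS]
  obtain ⟨K₀, hK₀⟩ := exists_nat_gt (w₁ / (2 * delta x))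
  have hK₀' (K : ℕ) (hK : K₀ ≤ K) : w₁ ≤ 2 * delta x * K := by
    have h1 : (K₀ : ℝ) ≤ K := by exact_mod_cast hK
    have := (div_lt_iff₀ (by positivity)).1 hK₀
    nlinarith
  have hK₀1 : 0 < K₀ := by
    have h0 : (0 : ℝ) < K₀ := lt_of_le_of_lt (div_nonneg (hδ.le.trans hδw) (by positivity)) hK₀
    exact_mod_cast h0
  set g : ℝ → ℝ := fun w => ∑ k ∈ Finset.range K₀, max 0 (θ ^ 2 * Real.exp w - noiseVar θ x k)
    with hg
  have hgc : Continuous g := by fun_prop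
  have hδN (k : ℕ) : θ ^ 2 * Real.exp (delta x) ≤ noiseVar θ x k := by
    rw [noiseVar_eq]
    gcongr
    nlinarith [(Nat.cast_nonneg k : (0 : ℝ) ≤ k)]
  have hg0 : g (delta x) = 0 :=
    Finset.sum_eq_zero fun k _ => max_eq_left (by linarith [hδN k])
  have hg1 : S ≤ g w₁ := by
    refine le_trans ?_ (Finset.single_le_sum (fun k _ => le_max_left _ _)
      (Finset.mem_range.2 hK₀1))
    rw [hew₁]
    refine le_trans ?_ (le_max_right _ _)
    simp
  obtain ⟨w, hw, hgw⟩ := intermediate_value_Icc hδw hgc.continuousOn ⟨hg0.le.trans hS, hg1⟩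
  refine ⟨w, hδ.le.trans hw.1, K₀, fun K hK => ?_⟩
  have hsum : ∑ k ∈ Finset.range K, max 0 (θ ^ 2 * Real.exp w - noiseVar θ x k) = S := by
    rw [← hgw]
    refine (Finset.sum_subset (Finset.range_subset_range.2 hK) fun k _ hk => ?_).symm
    refine max_eq_left (sub_nonpos.2 ?_)
    rw [noiseVar_eq]
    gcongr
    have h1 := hK₀' k (not_lt.1 fun h => hk (Finset.mem_range.2 h))
    linarith [hw.2]
  exact ⟨hw.2.trans (hK₀' K hK), hsum, capacityFirst_eq_of_waterLevel hθ x (by positivity) hsum⟩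

/-! ### Midpoint sums of antitone functions -/

lemma abs_midpoint_sum_sub_integral_le {f : ℝ → ℝ} (hf : Antitone f) (hf0 : ∀ u, 0 ≤ f u)
    {δ : ℝ} (hδ : 0 < δ) (K : ℕ) :
    |2 * δ * ∑ k ∈ Finset.range K, f (δ * (2 * k + 1)) - ∫ u in 0..(2 * δ * K), f u| ≤
      2 * δ * f 0 := by
  set h : ℝ → ℝ := fun s => f (2 * δ * s) with hh
  have hanti : Antitone h := fun s t hst => hf (by gcongr)
  have hint : ∫ u in 0..(2 * δ * K), f u = 2 * δ * ∫ s in (0 : ℝ)..(0 + K), h s := by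
    rw [hh, intervalIntegral.integral_comp_mul_left _ (by positivity)]
    simp
    field_simp
  have hlow : ∑ k ∈ Finset.range K, h ((k + 1 : ℕ)) ≤ ∫ s in (0 : ℝ)..(0 + K), h s := by
    have := (hanti.antitoneOn (Set.Icc (0 : ℝ) (0 + K))).sum_le_integral
    simpa using this
  have hupp : ∫ s in (0 : ℝ)..(0 + K), h s ≤ ∑ k ∈ Finset.range K, h (k : ℕ) := by
    have := (hanti.antitoneOn (Set.Icc (0 : ℝ) (0 + K))).integral_le_sum
    simpa using this
  have hmid1 : ∑ k ∈ Finset.range K, h ((k + 1 : ℕ)) ≤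
      ∑ k ∈ Finset.range K, f (δ * (2 * k + 1)) :=
    Finset.sum_le_sum fun k _ => hf (by push_cast; nlinarith)
  have hmid2 : ∑ k ∈ Finset.range K, f (δ * (2 * k + 1)) ≤ ∑ k ∈ Finset.range K, h (k : ℕ) :=
    Finset.sum_le_sum fun k _ => hf (by nlinarith)
  have htel : ∑ k ∈ Finset.range K, h (k : ℕ) ≤ ∑ k ∈ Finset.range K, h ((k + 1 : ℕ)) + f 0 := by
    have h1 := Finset.sum_range_sub (fun k : ℕ => h (k : ℝ)) K
    rw [Finset.sum_sub_distrib] at h1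
    have h2 : h ((0 : ℕ) : ℝ) = f 0 := by simp [hh]
    have h3 : 0 ≤ h (K : ℝ) := hf0 _
    linarith
  rw [hint, ← mul_sub, abs_mul, abs_of_pos (by positivity : 0 < 2 * δ)]
  refine mul_le_mul_of_nonneg_left ?_ (by positivity)
  rw [abs_le]
  constructor <;> linarith

/-! ### The two water-filling profiles -/

/-- The function `F(w) = ∫₀^∞ (e^w - e^u)⁺ du = w e^w - e^w + 1`, for `w ≥ 0`. -/
noncomputable def waterProfile (w : ℝ) : ℝ := w * Real.exp w - Real.exp w + 1

lemma integral_exp_sub_exp {w : ℝ} (hw : 0 ≤ w) {L : ℝ} (hL : w ≤ L) :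
    ∫ u in 0..L, max 0 (Real.exp w - Real.exp u) = waterProfile w := by
  have hc : Continuous fun u => max 0 (Real.exp w - Real.exp u) := by fun_prop
  rw [← intervalIntegral.integral_add_adjacent_intervals (b := w) (hc.intervalIntegrable _ _)
    (hc.intervalIntegrable _ _)]
  have h1 : ∫ u in 0..w, max 0 (Real.exp w - Real.exp u) = ∫ u in 0..w, (Real.exp w - Real.exp u) :=
    intervalIntegral.integral_congr fun u hu => by
      rw [Set.uIcc_of_le hw] at hu
      exact max_eq_right (sub_nonneg.2 (Real.exp_le_exp.2 hu.2))
  have h2 : ∫ u in w..L, max 0 (Real.exp w - Real.exp u) = ∫ u in w..L, (0 : ℝ) :=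
    intervalIntegral.integral_congr fun u hu => by
      rw [Set.uIcc_of_le hL] at hu
      exact max_eq_left (sub_nonpos.2 (Real.exp_le_exp.2 hu.1))
  rw [h1, h2, intervalIntegral.integral_sub (by simp) (Real.continuous_exp.intervalIntegrable _ _)]
  simp [waterProfile]
  ring

lemma integral_max_sub {w : ℝ} (hw : 0 ≤ w) {L : ℝ} (hL : w ≤ L) :
    ∫ u in 0..L, max 0 (w - u) = w ^ 2 / 2 := by
  have hc : Continuous fun u => max 0 (w - u) := by fun_prop
  rw [← intervalIntegral.integral_add_adjacent_intervals (b := w) (hc.intervalIntegrable _ _)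
    (hc.intervalIntegrable _ _)]
  have h1 : ∫ u in 0..w, max 0 (w - u) = ∫ u in 0..w, (w - u) :=
    intervalIntegral.integral_congr fun u hu => by
      rw [Set.uIcc_of_le hw] at hu
      exact max_eq_right (sub_nonneg.2 hu.2)
  have h2 : ∫ u in w..L, max 0 (w - u) = ∫ u in w..L, (0 : ℝ) :=
    intervalIntegral.integral_congr fun u hu => by
      rw [Set.uIcc_of_le hL] at hu
      exact max_eq_left (sub_nonpos.2 hu.1)
  rw [h1, h2, intervalIntegral.integral_sub (by simp) (continuous_id'.intervalIntegrable _ _)]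
  simp
  ring

lemma integral_Ioi_eq_intervalIntegral {f : ℝ → ℝ} {w : ℝ} (hw : 0 ≤ w)
    (hf : ∀ u, w < u → f u = 0) : ∫ u in Set.Ioi 0, f u = ∫ u in 0..w, f u := by
  rw [intervalIntegral.integral_of_le hw]
  refine setIntegral_eq_of_subset_of_forall_sdiff_eq_zero measurableSet_Ioi
    Set.Ioc_subset_Ioi_self fun u hu => hf u ?_
  by_contra h
  exact hu.2 ⟨hu.1, not_lt.1 h⟩

/-! ### Water-filling sums over the subchannels -/

lemma abs_energy_sum_sub_le {θ x w : ℝ} (hδ : 0 < delta x) (hw : 0 ≤ w) {K : ℕ}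
    (hK : w ≤ 2 * delta x * K) :
    |2 * delta x * ∑ k ∈ Finset.range K, max 0 (θ ^ 2 * Real.exp w - noiseVar θ x k) -
      θ ^ 2 * waterProfile w| ≤ 2 * delta x * (θ ^ 2 * Real.exp w) := by
  have hanti : Antitone fun u => max 0 (Real.exp w - Real.exp u) :=
    fun u v huv => max_le_max le_rfl (by gcongr)
  have h := abs_midpoint_sum_sub_integral_le hanti (fun u => le_max_left _ _) hδ K
  rw [integral_exp_sub_exp hw hK] at h
  have hsum : ∑ k ∈ Finset.range K, max 0 (θ ^ 2 * Real.exp w - noiseVar θ x k) =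
      θ ^ 2 * ∑ k ∈ Finset.range K, max 0 (Real.exp w - Real.exp (delta x * (2 * k + 1))) := by
    rw [Finset.mul_sum]
    refine Finset.sum_congr rfl fun k _ => ?_
    rw [noiseVar_eq, ← mul_sub, mul_max_of_nonneg _ _ (sq_nonneg θ), mul_zero]
  have h0 : max 0 (Real.exp w - Real.exp 0) ≤ Real.exp w :=
    max_le (Real.exp_pos w).le (by linarith [Real.exp_pos 0])
  rw [hsum, show ∀ A B : ℝ, 2 * delta x * (θ ^ 2 * A) - θ ^ 2 * B =
    θ ^ 2 * (2 * delta x * A - B) by intros; ring, abs_mul, abs_of_nonneg (sq_nonneg θ)]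
  calc _ ≤ θ ^ 2 * (2 * delta x * Real.exp w) := by
        refine mul_le_mul_of_nonneg_left (h.trans ?_) (sq_nonneg θ)
        exact mul_le_mul_of_nonneg_left h0 (by positivity)
    _ = _ := by ring

lemma logb_max_div_eq {c v u : ℝ} (hc : 0 < c) :
    Real.logb 2 (max (c * Real.exp v) (c * Real.exp u) / (c * Real.exp u)) =
      max 0 (v - u) / Real.log 2 := by
  rw [← mul_max_of_nonneg _ _ hc.le, mul_div_mul_left _ _ hc.ne', ← Real.exp_monotone.map_max,
    ← Real.exp_sub, Real.logb, Real.log_exp, max_comm 0, ← max_sub_sub_right, sub_self]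

lemma abs_capacity_sum_sub_le {θ x w : ℝ} (hθ : 0 < θ) (hδ : 0 < delta x) (hw : 0 ≤ w) {K : ℕ}
    (hK : w ≤ 2 * delta x * K) :
    |2 * delta x * ∑ k ∈ Finset.range K, 1 / 2 * Real.logb 2
        (max (θ ^ 2 * Real.exp w) (noiseVar θ x k) / noiseVar θ x k) -
      w ^ 2 / (4 * Real.log 2)| ≤ delta x * w / Real.log 2 := by
  have hlog2 : 0 < Real.log 2 := Real.log_pos one_lt_two
  have hanti : Antitone fun u => max 0 (w - u) :=
    fun u v huv => max_le_max le_rfl (by gcongr)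
  have h := abs_midpoint_sum_sub_integral_le hanti (fun u => le_max_left _ _) hδ K
  rw [integral_max_sub hw hK, sub_zero, max_eq_right hw] at h
  have hsum : ∑ k ∈ Finset.range K, 1 / 2 * Real.logb 2
        (max (θ ^ 2 * Real.exp w) (noiseVar θ x k) / noiseVar θ x k) =
      1 / (2 * Real.log 2) * ∑ k ∈ Finset.range K, max 0 (w - delta x * (2 * k + 1)) := by
    rw [Finset.mul_sum]
    refine Finset.sum_congr rfl fun k _ => ?_
    rw [noiseVar_eq, logb_max_div_eq (by positivity)]
    ring
  rw [hsum, show ∀ A : ℝ, 2 * delta x * (1 / (2 * Real.log 2) * A) - w ^ 2 / (4 * Real.log 2) =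
    1 / (2 * Real.log 2) * (2 * delta x * A - w ^ 2 / 2) by intros; ring, abs_mul,
    abs_of_pos (by positivity)]
  calc _ ≤ 1 / (2 * Real.log 2) * (2 * delta x * w) := by gcongr
    _ = _ := by field_simp

/-! ### Integrals over the time-frequency plane -/

lemma integral_plane_radial {g : ℝ → ℝ} :
    ∫ p : ℝ × ℝ, g (p.1 ^ 2 + p.2 ^ 2) = Real.pi * ∫ u in Set.Ioi 0, g u := by
  rw [← integral_comp_polarCoord_symm, polarCoord_target]
  have h1 : ∀ p : ℝ × ℝ, p.1 • g ((polarCoord.symm p).1 ^ 2 + (polarCoord.symm p).2 ^ 2) =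
      p.1 * g (p.1 ^ 2) * 1 := fun p => by
    rw [polarCoord_symm_apply, smul_eq_mul, mul_one]
    congr 2
    simp only
    linear_combination p.1 ^ 2 * Real.cos_sq_add_sin_sq p.2
  simp_rw [h1]
  rw [Measure.volume_eq_prod,
    setIntegral_prod_mul (fun r : ℝ => r * g (r ^ 2)) (fun _ : ℝ => (1 : ℝ)),
    ← integral_comp_rpow_Ioi_of_pos (g := g) two_pos]
  have h2 : ∀ r : ℝ, (2 * r ^ ((2 : ℝ) - 1)) • g (r ^ (2 : ℝ)) = 2 * (r * g (r ^ 2)) := fun r => by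
    rw [show (2 : ℝ) - 1 = 1 by norm_num, Real.rpow_one, Real.rpow_two, smul_eq_mul, mul_assoc]
  simp_rw [h2, integral_const_mul]
  simp
  rw [max_eq_left (by positivity)]
  ring

lemma integral_plane_elliptic {g : ℝ → ℝ} (hg : Continuous g) {α β : ℝ} (hα : 0 < α) (hβ : 0 < β) :
    ∫ p : ℝ × ℝ, g (p.1 ^ 2 / α ^ 2 + p.2 ^ 2 / β ^ 2) =
      Real.pi * (α * β) * ∫ u in Set.Ioi 0, g u := by
  have hmap : Measure.map (Prod.map (α⁻¹ * ·) (β⁻¹ * ·)) (volume : Measure (ℝ × ℝ)) =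
      ENNReal.ofReal (α * β) • volume := by
    rw [Measure.volume_eq_prod, ← Measure.map_prod_map _ _ (by fun_prop) (by fun_prop),
      Real.map_volume_mul_left (inv_ne_zero hα.ne'), Real.map_volume_mul_left (inv_ne_zero hβ.ne'),
      Measure.prod_smul_left, Measure.prod_smul_right, smul_smul, inv_inv, inv_inv,
      abs_of_pos hα, abs_of_pos hβ, ENNReal.ofReal_mul hα.le]
  have h := integral_map (μ := (volume : Measure (ℝ × ℝ)))
    (φ := Prod.map (α⁻¹ * ·) (β⁻¹ * ·)) (f := fun p : ℝ × ℝ => g (p.1 ^ 2 + p.2 ^ 2))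
    (Measurable.aemeasurable (by fun_prop)) (Continuous.aestronglyMeasurable (by fun_prop))
  rw [hmap, integral_smul_measure, integral_plane_radial,
    ENNReal.toReal_ofReal (by positivity)] at h
  have h2 : ∀ p : ℝ × ℝ, g (p.1 ^ 2 / α ^ 2 + p.2 ^ 2 / β ^ 2) =
      g ((Prod.map (α⁻¹ * ·) (β⁻¹ * ·) p).1 ^ 2 + (Prod.map (α⁻¹ * ·) (β⁻¹ * ·) p).2 ^ 2) :=
    fun p => by
      simp only [Prod.map]
      congr 1
      field_simp
  simp_rw [h2]
  rw [← h, smul_eq_mul]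
  ring

/-- The minimum `(θ² / 2π) cosh δ` of `N(t, ω)`. -/
noncomputable def floorNoise (θ x : ℝ) : ℝ := θ ^ 2 / (2 * Real.pi) * Real.cosh (delta x)

lemma floorNoise_pos {θ : ℝ} (hθ : 0 < θ) (x : ℝ) : 0 < floorNoise θ x := by
  have := Real.cosh_pos (delta x)
  have := Real.pi_pos
  unfold floorNoise
  positivity

/-- The logarithmic water height `v = log⁺ (ν / c)` over the minimum `c` of `N(t, ω)`; it is `0`
when the level `ν` does not exceed `c`. -/
noncomputable def waterHeight (θ x ν : ℝ) : ℝ := Real.log (max ν (floorNoise θ x) / floorNoise θ x)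

lemma waterHeight_nonneg {θ : ℝ} (hθ : 0 < θ) (x ν : ℝ) : 0 ≤ waterHeight θ x ν :=
  Real.log_nonneg ((one_le_div (floorNoise_pos hθ x)).2 (le_max_right _ _))

lemma max_sub_noise_eq {θ : ℝ} (hθ : 0 < θ) (x ν : ℝ) {u : ℝ} (hu : 0 ≤ u) :
    max 0 (ν - floorNoise θ x * Real.exp u) =
      floorNoise θ x * max 0 (Real.exp (waterHeight θ x ν) - Real.exp u) := by
  have hc := floorNoise_pos hθ x
  have h1 : 1 ≤ Real.exp u := Real.one_le_exp hu
  rw [waterHeight, Real.exp_log (div_pos (lt_max_of_lt_right hc) hc),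
    mul_max_of_nonneg _ _ hc.le, mul_zero, mul_sub, mul_div_cancel₀ _ hc.ne']
  rcases le_total ν (floorNoise θ x) with h | h
  · rw [max_eq_right h, max_eq_left (by nlinarith), max_eq_left (by nlinarith)]
  · rw [max_eq_left h]

lemma waterVolume_eq {θ α β : ℝ} (hθ : 0 < θ) (hα : 0 < α) (hβ : 0 < β) (ν : ℝ) :
    waterVolume θ α β ν = α * β * (θ ^ 2 * Real.cosh (delta (α * β)) / 2 *
      waterProfile (waterHeight θ (α * β) ν)) := by
  set v := waterHeight θ (α * β) ν with hv
  have hv0 : 0 ≤ v := waterHeight_nonneg hθ _ _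
  have h := integral_plane_elliptic
    (g := fun u => max 0 (Real.exp v - Real.exp u)) (by fun_prop) hα hβ
  rw [integral_Ioi_eq_intervalIntegral hv0
    (fun u hu => max_eq_left (sub_nonpos.2 (Real.exp_le_exp.2 hu.le))),
    integral_exp_sub_exp hv0 le_rfl] at h
  rw [waterVolume]
  have h2 : ∀ p : ℝ × ℝ, max 0 (ν - N θ α β p.1 p.2) =
      floorNoise θ (α * β) * max 0 (Real.exp v - Real.exp (p.1 ^ 2 / α ^ 2 + p.2 ^ 2 / β ^ 2)) :=
    fun p => max_sub_noise_eq hθ (α * β) ν (by positivity)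
  simp_rw [h2]
  rw [integral_const_mul, h, floorNoise]
  have := Real.pi_pos
  field_simp

lemma waterCapacity_eq {θ α β : ℝ} (hθ : 0 < θ) (hα : 0 < α) (hβ : 0 < β) (ν : ℝ) :
    waterCapacity θ α β ν = α * β * (waterHeight θ (α * β) ν ^ 2 / (8 * Real.log 2)) := by
  set v := waterHeight θ (α * β) ν with hv
  have hv0 : 0 ≤ v := waterHeight_nonneg hθ _ _
  have hlog2 : 0 < Real.log 2 := Real.log_pos one_lt_two
  have h := integral_plane_elliptic
    (g := fun u => max 0 (v - u)) (by fun_prop) hα hβ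
  rw [integral_Ioi_eq_intervalIntegral hv0
    (fun u hu => max_eq_left (sub_nonpos.2 hu.le)), integral_max_sub hv0 le_rfl] at h
  rw [waterCapacity]
  have h2 : ∀ p : ℝ × ℝ,
      1 / 2 * Real.logb 2 (1 + max 0 (ν - N θ α β p.1 p.2) / N θ α β p.1 p.2) =
      1 / (2 * Real.log 2) * max 0 (v - (p.1 ^ 2 / α ^ 2 + p.2 ^ 2 / β ^ 2)) := fun p => by
    set u := p.1 ^ 2 / α ^ 2 + p.2 ^ 2 / β ^ 2 with hu
    have hc := floorNoise_pos hθ (α * β)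
    have hN : N θ α β p.1 p.2 = floorNoise θ (α * β) * Real.exp u := rfl
    have hN0 : 0 < floorNoise θ (α * β) * Real.exp u := mul_pos hc (Real.exp_pos _)
    rw [hN, max_sub_noise_eq hθ (α * β) ν (by positivity), ← hv]
    have h3 : 1 + floorNoise θ (α * β) * max 0 (Real.exp v - Real.exp u) /
        (floorNoise θ (α * β) * Real.exp u) =
        max (floorNoise θ (α * β) * Real.exp v) (floorNoise θ (α * β) * Real.exp u) /
          (floorNoise θ (α * β) * Real.exp u) := by
      rw [← mul_max_of_nonneg _ _ hc.le, ← div_self hN0.ne', ← add_div, ← mul_add,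
        add_comm, max_add, zero_add, sub_add_cancel, max_comm]
    rw [h3, logb_max_div_eq hc]
    ring
  simp_rw [h2]
  rw [integral_const_mul, h]
  have := Real.pi_pos
  field_simp
  ring

/-! ### Asymptotics -/

lemma delta_bounds {x : ℝ} (hx : 1 < x) : 1 / (x + 1) ≤ delta x ∧ delta x ≤ 1 / (x - 1) := by
  have hx0 : 0 < x := by linarith
  have hx1 : 0 < x - 1 := by linarith
  have h1x : 1 / x ≤ 1 := (div_le_one hx0).2 hx.le
  have hq : (1 + 1 / x) / (1 - 1 / x) = (x + 1) / (x - 1) := by field_simp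
  rw [delta, Real.artanh_eq_half_log ⟨by linarith [show 0 < 1 / x by positivity], h1x⟩, hq]
  have hpos : 0 < (x + 1) / (x - 1) := by positivity
  have hup := Real.log_le_sub_one_of_pos hpos
  have hlo := Real.one_sub_inv_le_log_of_pos hpos
  have e1 : (x + 1) / (x - 1) - 1 = 2 * (1 / (x - 1)) := by field_simp; ring
  have e2 : 1 - ((x + 1) / (x - 1))⁻¹ = 2 * (1 / (x + 1)) := by field_simp; ring
  constructor <;> linarith

lemma delta_pos {x : ℝ} (hx : 1 < x) : 0 < delta x :=
  lt_of_lt_of_le (by positivity) (delta_bounds hx).1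

lemma tendsto_delta : Tendsto delta atTop (𝓝 0) := by
  have h : Tendsto (fun x : ℝ => 1 / (x - 1)) atTop (𝓝 0) := by
    simp_rw [one_div]
    exact (tendsto_atTop_add_const_right atTop (-1 : ℝ) tendsto_id).inv_tendsto_atTop
  refine tendsto_of_tendsto_of_tendsto_of_le_of_le' tendsto_const_nhds h ?_ ?_
  · filter_upwards [eventually_gt_atTop 1] with x hx using (delta_pos hx).le
  · filter_upwards [eventually_gt_atTop 1] with x hx using (delta_bounds hx).2

lemma tendsto_delta_mul_self : Tendsto (fun x => delta x * x) atTop (𝓝 1) := by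
  have hi : Tendsto (fun x : ℝ => x⁻¹) atTop (𝓝 0) := tendsto_inv_atTop_zero
  have hl : Tendsto (fun x : ℝ => 1 / (1 + x⁻¹)) atTop (𝓝 1) := by
    simp_rw [one_div]
    simpa using (hi.const_add 1).inv₀ (by norm_num)
  have hu : Tendsto (fun x : ℝ => 1 / (1 - x⁻¹)) atTop (𝓝 1) := by
    simp_rw [one_div]
    simpa using (hi.const_sub 1).inv₀ (by norm_num)
  refine tendsto_of_tendsto_of_tendsto_of_le_of_le' hl hu ?_ ?_
  · filter_upwards [eventually_gt_atTop 1] with x hx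
    have hx0 : 0 < x := by linarith
    calc 1 / (1 + x⁻¹) = 1 / (x + 1) * x := by field_simp
      _ ≤ _ := mul_le_mul_of_nonneg_right (delta_bounds hx).1 hx0.le
  · filter_upwards [eventually_gt_atTop 1] with x hx
    have hx0 : 0 < x := by linarith
    have hx1 : 0 < x - 1 := by linarith
    calc _ ≤ 1 / (x - 1) * x := mul_le_mul_of_nonneg_right (delta_bounds hx).2 hx0.le
      _ = 1 / (1 - x⁻¹) := by field_simp

lemma tendsto_cosh_delta : Tendsto (fun x => Real.cosh (delta x)) atTop (𝓝 1) := by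
  rw [← Real.cosh_zero]
  exact (Real.continuous_cosh.tendsto 0).comp tendsto_delta

lemma waterProfile_sub_half_sq_monotoneOn :
    MonotoneOn (fun w => waterProfile w - w ^ 2 / 2) (Set.Ici 0) := by
  have hd (w : ℝ) : HasDerivAt (fun w => waterProfile w - w ^ 2 / 2) (w * Real.exp w - w) w := by
    have h1 := ((((hasDerivAt_id w).mul (Real.hasDerivAt_exp w)).sub
      (Real.hasDerivAt_exp w)).add_const 1).sub (((hasDerivAt_id w).pow 2).div_const 2)
    refine h1.congr_deriv ?_
    simp
  refine monotoneOn_of_deriv_nonneg (convex_Ici 0)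
    (fun w _ => (hd w).continuousAt.continuousWithinAt)
    (fun w _ => (hd w).differentiableAt.differentiableWithinAt) fun w hw => ?_
  rw [interior_Ici, Set.mem_Ioi] at hw
  rw [(hd w).deriv]
  nlinarith [Real.one_le_exp hw.le]

/-- The squared height `w²` is a Lipschitz function of the profile `F(w)`, with constant `2`. -/
lemma abs_sq_sub_sq_le {v w : ℝ} (hv : 0 ≤ v) (hw : 0 ≤ w) :
    |w ^ 2 - v ^ 2| ≤ 2 * |waterProfile v - waterProfile w| := by
  wlog h : w ≤ v generalizing v w
  · rw [abs_sub_comm, abs_sub_comm (waterProfile v)]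
    exact this hw hv (le_of_not_ge h)
  have hm := waterProfile_sub_half_sq_monotoneOn hw hv h
  simp only at hm
  have hsq : w ^ 2 ≤ v ^ 2 := by gcongr
  rw [abs_sub_comm, abs_of_nonneg (by linarith), abs_of_nonneg (by linarith)]
  linarith

lemma waterProfile_nonneg {w : ℝ} (hw : 0 ≤ w) : 0 ≤ waterProfile w := by
  have := waterProfile_sub_half_sq_monotoneOn (Set.self_mem_Ici) hw hw
  simp [waterProfile] at this ⊢
  nlinarith [sq_nonneg w]

lemma tendsto_zero_mul_of_abs_le {X : Type*} {l : Filter X} {f g : X → ℝ} {B : ℝ}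
    (hf : Tendsto f l (𝓝 0)) (hg : ∀ᶠ x in l, |g x| ≤ B) :
    Tendsto (fun x => f x * g x) l (𝓝 0) :=
  hf.zero_mul_isBoundedUnder_le (isBoundedUnder_of_eventually_le hg)

/-- The capacity and the energy expressed through the logarithmic water height `w`, up to the
errors of the midpoint sums. -/
lemma exists_waterHeight {θ : ℝ} (hθ : 0 < θ) {x : ℝ} (hx : 1 < x) {S : ℝ} (hS : 0 ≤ S) :
    Tendsto (capacityFirst θ x S) atTop (𝓝 (capacity θ x S)) ∧ capacity θ x S ≠ ∞ ∧
    ∃ w : ℝ, 0 ≤ w ∧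
      |2 * delta x * S - θ ^ 2 * waterProfile w| ≤ 2 * delta x * (θ ^ 2 * Real.exp w) ∧
      |2 * delta x * (capacity θ x S).toReal - w ^ 2 / (4 * Real.log 2)| ≤
        delta x * w / Real.log 2 := by
  obtain ⟨w, hw, K₀, hK⟩ := exists_waterLevel hθ (delta_pos hx) hS
  obtain ⟨hwK, hsum, hcap⟩ := hK K₀ le_rfl
  -- The noise of the subchannels from `K₀` on exceeds the water level: they contribute nothing.
  have hconst : ∀ K ≥ K₀, capacityFirst θ x S K = capacityFirst θ x S K₀ := fun K hKK => by
    rw [(hK K hKK).2.2, hcap]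
    congr 1
    refine (Finset.sum_subset (Finset.range_subset_range.2 hKK) fun k _ hk => ?_).symm
    have hk' : (K₀ : ℝ) ≤ k := by exact_mod_cast not_lt.1 fun h => hk (Finset.mem_range.2 h)
    have hδ := delta_pos hx
    rw [noiseVar_eq, logb_max_div_eq (pow_pos hθ 2), max_eq_left (by nlinarith)]
    simp
  have htend : Tendsto (capacityFirst θ x S) atTop (𝓝 (capacityFirst θ x S K₀)) :=
    tendsto_const_nhds.congr' ((eventually_ge_atTop K₀).mono fun K h => (hconst K h).symm)
  have hlim : capacity θ x S = capacityFirst θ x S K₀ := htend.limUnder_eq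
  rw [hlim]
  refine ⟨htend, hcap ▸ ENNReal.ofReal_ne_top, w, hw, ?_, ?_⟩
  · have h := abs_energy_sum_sub_le (θ := θ) (delta_pos hx) hw hwK
    rwa [hsum] at h
  · rw [hcap, ENNReal.toReal_ofReal]
    · exact abs_capacity_sum_sub_le hθ (delta_pos hx) hw hwK
    · refine Finset.sum_nonneg fun k _ => mul_nonneg (by norm_num) ?_
      exact Real.logb_nonneg one_lt_two
        ((one_le_div (noiseVar_pos hθ x k)).2 (le_max_right _ _))

/-- If the energy is `O(x)`, the logarithmic water height stays bounded. -/
lemma eventually_waterHeight_le {θ : ℝ} (hθ : 0 < θ) {S w : ℝ → ℝ} {M : ℝ}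
    (hS : ∀ᶠ x in atTop, |S x / x| ≤ M)
    (hw : ∀ x, 1 < x →
      |2 * delta x * S x - θ ^ 2 * waterProfile (w x)| ≤ 2 * delta x * (θ ^ 2 * Real.exp (w x))) :
    ∀ᶠ x in atTop, w x ≤ max 3 (4 * M / θ ^ 2) := by
  filter_upwards [hS, eventually_gt_atTop 1,
    tendsto_delta.eventually (gt_mem_nhds (by norm_num : (0 : ℝ) < 1 / 2)),
    tendsto_delta_mul_self.eventually (gt_mem_nhds one_lt_two)] with x hSx hx hδ hδx
  have hθ2 : 0 < θ ^ 2 := pow_pos hθ 2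
  have hx0 : 0 < x := by linarith
  have hδ0 := delta_pos hx
  have hM : 0 ≤ M := (abs_nonneg _).trans hSx
  have h1 : 2 * delta x * S x ≤ 4 * M := by
    calc 2 * delta x * S x = 2 * (delta x * x) * (S x / x) := by field_simp
      _ ≤ 2 * (delta x * x) * M := by
        gcongr
        exact (le_abs_self _).trans hSx
      _ ≤ 4 * M := by nlinarith
  have h2 := (abs_le.1 (hw x hx)).1
  have h3 : 2 * delta x * (θ ^ 2 * Real.exp (w x)) ≤ θ ^ 2 * Real.exp (w x) := by
    have : 0 < θ ^ 2 * Real.exp (w x) := by positivity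
    nlinarith
  rcases le_total (w x) 3 with h | h
  · exact h.trans (le_max_left _ _)
  · refine le_max_of_le_right ?_
    rw [le_div_iff₀ hθ2]
    have h4 : θ ^ 2 * (Real.exp (w x) * (w x - 2) + 1) ≤ 4 * M := by
      rw [waterProfile] at h2
      nlinarith
    have h5 : w x ≤ Real.exp (w x) * (w x - 2) + 1 := by
      nlinarith [Real.add_one_le_exp (w x), Real.exp_pos (w x)]
    nlinarith

lemma tendsto_mul_timeFreqAtTop :
    Tendsto (fun p : ℝ × ℝ => p.1 * p.2) timeFreqAtTop atTop :=
  tendsto_comap.mono_left inf_le_left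

lemma eventually_pos_timeFreqAtTop : ∀ᶠ p in timeFreqAtTop, 0 < p.1 ∧ 0 < p.2 :=
  mem_inf_of_right (mem_principal_self _)

end HeatChannel

theorem theorem2 (θ : ℝ) (hθ : 0 < θ) (S : ℝ → ℝ) (hS0 : ∀ x, 1 < x → 0 ≤ S x)
    (hS : S =O[atTop] (fun x : ℝ => x)) :
    (∀ x, 1 < x →
      Tendsto (HeatChannel.capacityFirst θ x (S x)) atTop (𝓝 (HeatChannel.capacity θ x (S x))) ∧
        HeatChannel.capacity θ x (S x) ≠ ∞) ∧
    (∃ ν : ℝ → ℝ, HeatChannel.AsympEq (fun α β => S (α * β))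
      (fun α β => HeatChannel.waterVolume θ α β (ν (α * β)))) ∧
    ∀ ν : ℝ → ℝ → ℝ,
      HeatChannel.AsympEq (fun α β => S (α * β))
        (fun α β => HeatChannel.waterVolume θ α β (ν α β)) →
      HeatChannel.AsympEq (fun α β => (HeatChannel.capacity θ (α * β) (S (α * β))).toReal)
        (fun α β => HeatChannel.waterCapacity θ α β (ν α β)) := by
  open HeatChannel in
  refine ⟨fun x hx => ?_, ?_⟩
  · have h := exists_waterHeight hθ hx (hS0 x hx)
    exact ⟨h.1, h.2.1⟩
  have hθ2 : 0 < θ ^ 2 := pow_pos hθ 2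
  have hlog2 : 0 < Real.log 2 := Real.log_pos one_lt_two
  have hex : ∀ x, ∃ w : ℝ, 1 < x → 0 ≤ w ∧
      |2 * delta x * S x - θ ^ 2 * waterProfile w| ≤ 2 * delta x * (θ ^ 2 * Real.exp w) ∧
      |2 * delta x * (capacity θ x (S x)).toReal - w ^ 2 / (4 * Real.log 2)| ≤
        delta x * w / Real.log 2 := fun x => by
    by_cases hx : 1 < x
    · obtain ⟨w, hw⟩ := (exists_waterHeight hθ hx (hS0 x hx)).2.2
      exact ⟨w, fun _ => hw⟩
    · exact ⟨0, fun h => absurd h hx⟩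
  choose w hw using hex
  obtain ⟨M, hM⟩ := hS.bound
  have hSx : ∀ᶠ x in atTop, |S x / x| ≤ M := by
    filter_upwards [hM, eventually_gt_atTop 0] with x h hx
    rwa [abs_div, div_le_iff₀ (abs_pos.2 hx.ne')]
  set B := max 3 (4 * M / θ ^ 2) with hB
  have hwB : ∀ᶠ x in atTop, 0 ≤ w x ∧ w x ≤ B := by
    filter_upwards [eventually_waterHeight_le hθ hSx fun x hx => (hw x hx).2.1,
      eventually_gt_atTop 1] with x h hx using ⟨(hw x hx).1, h⟩
  have hFB : ∀ᶠ x in atTop, |waterProfile (w x)| ≤ B * Real.exp B + 1 := by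
    filter_upwards [hwB] with x hx
    rw [abs_of_nonneg (waterProfile_nonneg hx.1), waterProfile]
    have h1 : w x * Real.exp (w x) ≤ B * Real.exp B :=
      mul_le_mul hx.2 (Real.exp_le_exp.2 hx.2) (Real.exp_pos _).le (hx.1.trans hx.2)
    linarith [Real.exp_pos (w x)]
  have hδ1 : Tendsto (fun x => 1 - delta x * x) atTop (𝓝 0) := by
    simpa using tendsto_delta_mul_self.const_sub 1
  have hδ2 : Tendsto (fun x => (delta x * x)⁻¹ - 1) atTop (𝓝 0) := by
    simpa using (tendsto_delta_mul_self.inv₀ one_ne_zero).sub_const 1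
  -- The energy: `S(x) / x = θ² F(w) / 2 + o(1)`.
  have hE : Tendsto (fun x => S x / x - θ ^ 2 * waterProfile (w x) / 2) atTop (𝓝 0) := by
    have h1 := tendsto_zero_mul_of_abs_le hδ1 hSx
    have h2 : Tendsto (fun x => (2 * delta x * S x - θ ^ 2 * waterProfile (w x)) / 2)
        atTop (𝓝 0) := by
      refine squeeze_zero_norm' (a := fun x => delta x * (θ ^ 2 * Real.exp B)) ?_
        (by simpa using tendsto_delta.mul_const (θ ^ 2 * Real.exp B))
      filter_upwards [hwB, eventually_gt_atTop 1] with x hx hx1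
      have hδ := delta_pos hx1
      have h3 : 2 * delta x * (θ ^ 2 * Real.exp (w x)) ≤ 2 * delta x * (θ ^ 2 * Real.exp B) := by
        gcongr
        exact hx.2
      rw [Real.norm_eq_abs, abs_div, abs_two, div_le_iff₀ two_pos]
      linarith [(hw x hx1).2.1]
    have hsum := h1.add h2
    rw [add_zero] at hsum
    refine hsum.congr' ?_
    filter_upwards [eventually_gt_atTop 0] with x hx
    field_simp
    ring
  -- The capacity: `C(S(x)) / x = w² / (8 log 2) + o(1)`.
  have hC : Tendsto (fun x => (capacity θ x (S x)).toReal / x - w x ^ 2 / (8 * Real.log 2))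
      atTop (𝓝 0) := by
    have h2 : Tendsto (fun x => (2 * delta x * (capacity θ x (S x)).toReal -
        w x ^ 2 / (4 * Real.log 2)) / 2) atTop (𝓝 0) := by
      refine squeeze_zero_norm' (a := fun x => delta x * (B / Real.log 2 / 2)) ?_
        (by simpa using tendsto_delta.mul_const (B / Real.log 2 / 2))
      filter_upwards [hwB, eventually_gt_atTop 1] with x hx hx1
      have hδ := delta_pos hx1
      rw [Real.norm_eq_abs, abs_div, abs_two]
      calc _ ≤ delta x * w x / Real.log 2 / 2 := by
            gcongr
            exact (hw x hx1).2.2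
        _ ≤ delta x * B / Real.log 2 / 2 := by
            gcongr
            exact hx.2
        _ = _ := by ring
    have h3 : ∀ᶠ x in atTop, |delta x * (capacity θ x (S x)).toReal| ≤
        B ^ 2 / (8 * Real.log 2) + 1 := by
      filter_upwards [hwB, h2.eventually (Metric.ball_mem_nhds 0 one_pos)] with x hx h
      rw [Real.dist_eq, sub_zero] at h
      have h4 : w x ^ 2 / (8 * Real.log 2) ≤ B ^ 2 / (8 * Real.log 2) := by
        gcongr
        exacts [hx.1, hx.2]
      have h5 : 0 ≤ w x ^ 2 / (8 * Real.log 2) := by positivity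
      have h6 : delta x * (capacity θ x (S x)).toReal =
          (2 * delta x * (capacity θ x (S x)).toReal - w x ^ 2 / (4 * Real.log 2)) / 2 +
            w x ^ 2 / (8 * Real.log 2) := by
        field_simp
        ring
      rw [h6]
      refine (abs_add_le _ _).trans ?_
      rw [abs_of_nonneg h5]
      linarith
    have h1 := tendsto_zero_mul_of_abs_le hδ2 h3
    have hsum := h1.add h2
    rw [add_zero] at hsum
    refine hsum.congr' ?_
    filter_upwards [eventually_gt_atTop 1] with x hx
    have hδ := delta_pos hx
    have hx0 : 0 < x := by linarith
    field_simp
    ring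
  have hcosh : Tendsto (fun x => 1 - Real.cosh (delta x)) atTop (𝓝 0) := by
    simpa using tendsto_cosh_delta.const_sub 1
  have hcosh' : Tendsto (fun x => (Real.cosh (delta x))⁻¹ - 1) atTop (𝓝 0) := by
    simpa using (tendsto_cosh_delta.inv₀ one_ne_zero).sub_const 1
  have hp := tendsto_mul_timeFreqAtTop
  refine ⟨⟨fun x => floorNoise θ x * Real.exp (w x), ?_⟩, fun ν hν => ?_⟩
  · have h1 := (tendsto_zero_mul_of_abs_le hcosh hFB).const_mul (θ ^ 2 / 2)
    rw [mul_zero] at h1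
    have hsum := (hE.comp hp).add (h1.comp hp)
    rw [add_zero] at hsum
    refine hsum.congr' ?_
    filter_upwards [eventually_pos_timeFreqAtTop, hp.eventually hwB] with p hpp hpw
    have hc := floorNoise_pos hθ (p.1 * p.2)
    have hheight : waterHeight θ (p.1 * p.2)
        (floorNoise θ (p.1 * p.2) * Real.exp (w (p.1 * p.2))) = w (p.1 * p.2) := by
      rw [waterHeight, max_eq_left (le_mul_of_one_le_right hc.le (Real.one_le_exp hpw.1)),
        mul_div_cancel_left₀ _ hc.ne', Real.log_exp]
    have hpos := mul_pos hpp.1 hpp.2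
    simp only [Function.comp]
    rw [waterVolume_eq hθ hpp.1 hpp.2, hheight, sub_div, mul_div_cancel_left₀ _ hpos.ne']
    ring
  · set v : ℝ × ℝ → ℝ := fun p => waterHeight θ (p.1 * p.2) (ν p.1 p.2) with hv
    have hv0 (p) : 0 ≤ v p := waterHeight_nonneg hθ _ _
    -- `cosh δ F(v) - F(w) → 0` and `cosh δ → 1` give `F(v) - F(w) → 0`.
    have h1 : Tendsto (fun p : ℝ × ℝ => Real.cosh (delta (p.1 * p.2)) * waterProfile (v p) -
        waterProfile (w (p.1 * p.2))) timeFreqAtTop (𝓝 0) := by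
      have h := ((hE.comp hp).sub hν).const_mul (2 / θ ^ 2)
      rw [sub_zero, mul_zero] at h
      refine h.congr' ?_
      filter_upwards [eventually_pos_timeFreqAtTop] with p hpp
      have hpos := mul_pos hpp.1 hpp.2
      simp only [Function.comp]
      rw [waterVolume_eq hθ hpp.1 hpp.2, sub_div, mul_div_cancel_left₀ _ hpos.ne']
      field_simp
      ring
    have h2 : Tendsto (fun p => waterProfile (v p) - waterProfile (w (p.1 * p.2)))
        timeFreqAtTop (𝓝 0) := by
      have h3 := h1.mul ((tendsto_cosh_delta.inv₀ one_ne_zero).comp hp)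
      have h4 := (tendsto_zero_mul_of_abs_le hcosh' hFB).comp hp
      have hsum := h3.add h4
      rw [zero_mul, add_zero] at hsum
      refine hsum.congr fun p => ?_
      have := Real.cosh_pos (delta (p.1 * p.2))
      simp only [Function.comp]
      field_simp
      ring
    have h3 : Tendsto (fun p => w (p.1 * p.2) ^ 2 - v p ^ 2) timeFreqAtTop (𝓝 0) := by
      refine squeeze_zero_norm' (a := fun p => 2 * |waterProfile (v p) -
        waterProfile (w (p.1 * p.2))|) ?_ (by simpa using h2.abs.const_mul 2)
      filter_upwards [hp.eventually hwB] with p hpw using abs_sq_sub_sq_le (hv0 p) hpw.1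
    have h4 := (hC.comp hp).add (h3.mul_const (1 / (8 * Real.log 2)))
    rw [zero_mul, zero_add] at h4
    refine h4.congr' ?_
    filter_upwards [eventually_pos_timeFreqAtTop] with p hpp
    have hpos := mul_pos hpp.1 hpp.2
    simp only [Function.comp]
    rw [waterCapacity_eq hθ hpp.1 hpp.2, sub_div, mul_div_cancel_left₀ _ hpos.ne']
    simp only [hv]
    ring
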